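/- Let $\Sigma$ and $\Xi$ be finite sets, let $P_{\mathcal E}$ be a probability distribution on $\Sigma$ (the current posterior over the environment $\mathcal E$), and let $d:\Sigma\times\Xi\to[0,\infty)$ be a distortion function such that, for every $e\in\Sigma$ with $P_{\mathcal E}(e)>0$, one has $d(e,x)\le 1$ for all $x\in\Xi$ and $d(e,x)=0$ for some $x\in\Xi$. Assume that $d(e,x)>0$ for at least one pair with $P_{\mathcal E}(e)>0$, and put $$D(P_{\mathcal E})=\min\{d(e,x)\;:\;P_{\mathcal E}(e)>0,\ d(e,x)>0\}.$$ For a probability distribution $Q$ on $\Sigma$ and $D\ge 0$ let $$\mathcal R_Q(D)=\inf\bigl\{\mathbb I(\rho)\;:\;\rho\text{ a probability distribution on }\Sigma\times\Xi\text{ with }\Sigma\text{-marginal }Q\text{ and }\mathbb E_\rho[d]\le D\bigr\},$$ where $\mathbb I(\rho)=D_{\mathrm{KL}}(\rho\,\|\,\rho_\Sigma\times\rho_\Xi)$ is the mutual information (all logarithms are natural). Let $\mathcal E_1,\dots,\mathcal E_z$ be independent samples from $P_{\mathcal E}$, let $\widehat P_{\mathcal E}=\frac1z\sum_{i=1}^z\mathbf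 1_{\mathcal E_i}$ be their empirical distribution, and write $\mathcal R(D)=\mathcal R_{P_{\mathcal E}}(D)$ and $\widehat{\mathcal R}(D)=\mathcal R_{\widehat P_{\mathcal E}}(D)$. Let $\delta\in(0,1)$ and $\varepsilon\in(0,\log|\Sigma|)$, and let $\phi^{-1}$ be the inverse of the function $\phi:[0,\tfrac12]\to\mathbb R$, $\phi(t)=t\log\frac{|\Sigma||\Xi|}{t}$, $\phi(0)=0$. If $$z\;\ge\;\frac{2}{\phi^{-1}\!\left(\frac{\varepsilon D(P_{\mathcal E})}{7}\right)^2}\left(\log\frac1\delta+|\Sigma|\log 2\right),$$ then, for every $D\ge0$, $\mathcal R(D)$ is finite, $\widehat{\mathcal R}(D)$ is almost surely finite, and $$\mathbb P\bigl(|\mathcal R(D)-\widehat{\mathcal R}(D)|\ge\varepsilon\bigr)\le\delta.$$ -/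

import Mathlib

open MeasureTheory ProbabilityTheory
open scoped NNReal ENNReal

namespace RateDistortion

noncomputable section

/-- The mutual information (in nats) of a pair with joint law `ρ`: the Kullback-Leibler divergence
of `ρ` from the product of its two marginals. -/
def mutualInfo {S Ξ : Type*} [MeasurableSpace S] [MeasurableSpace Ξ]
    (ρ : Measure (S × Ξ)) : ℝ≥0∞ :=
  InformationTheory.klDiv ρ (ρ.fst.prod ρ.snd)

/-- The joint probability measures whose first marginal is the source `P` and whose expected
distortion is at most `D`. -/
def feasible {S Ξ : Type*} [MeasurableSpace S] [MeasurableSpace Ξ]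
    (d : S → Ξ → ℝ≥0) (P : Measure S) (D : ℝ≥0) : Set (Measure (S × Ξ)) :=
  {ρ | IsProbabilityMeasure ρ ∧ ρ.fst = P ∧ ∫⁻ p, (d p.1 p.2 : ℝ≥0∞) ∂ρ ≤ (D : ℝ≥0∞)}

/-- The rate-distortion function of the source `P` at distortion level `D`
(equal to `∞` if no joint law is feasible). -/
def rate {S Ξ : Type*} [MeasurableSpace S] [MeasurableSpace Ξ]
    (d : S → Ξ → ℝ≥0) (P : Measure S) (D : ℝ≥0) : ℝ≥0∞ :=
  ⨅ ρ ∈ feasible d P D, mutualInfo ρ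

/-- The empirical distribution of the points `x 0, …, x (z - 1)`. -/
def empirical {S : Type*} [MeasurableSpace S] {z : ℕ} (x : Fin z → S) : Measure S :=
  (z : ℝ≥0∞)⁻¹ • ∑ i, Measure.dirac (x i)

/-- The positive values that the distortion takes on rows of positive `P`-probability. -/
def positiveDistortions {S Ξ : Type*} [MeasurableSpace S]
    (d : S → Ξ → ℝ≥0) (P : Measure S) : Set ℝ :=
  {r | ∃ s x, 0 < P {s} ∧ 0 < d s x ∧ r = d s x}

/-- The least positive distortion on the support of `P` (a minimum when `S` and `Ξ` are finite
and there is a positive distortion on the support of `P`). -/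
def minDistortion {S Ξ : Type*} [MeasurableSpace S]
    (d : S → Ξ → ℝ≥0) (P : Measure S) : ℝ :=
  sInf (positiveDistortions d P)

/-- `φ(t) = t log (K / t)`, with value `0` at `t = 0`. -/
def phi (K t : ℝ) : ℝ := t * Real.log (K / t)

/-- The inverse of the restriction of `phi K` to `[0, 1/2]`. -/
def phiInv (K : ℝ) : ℝ → ℝ := Function.invFunOn (phi K) (Set.Icc 0 (1 / 2))

end

end RateDistortion

open RateDistortion

namespace RateDistortion

/-! The rate is continuous in the source, uniformly in `D`. A joint law feasible for `P` becomes one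
feasible for `Q` by keeping, in each row, the fraction of mass common to both sources and sending
the excess of `Q` to a letter of zero distortion. The expected distortion does not grow, and the
joint law moves in `ℓ¹` no further than the sources (`rate_le_add`). Mutual information is a
combination of three entropies, each moving by at most `phi K η + η` when the `ℓ¹` distance is at
most `η` (`mutualInfo_le_add`). With `phi K η = ε * minDistortion d P / 7` and `η ≤ phi K η`, the
rates differ by at most `6ε/7`; the least distortion enters only through lying in `(0, 1]`. The `ℓ¹`
distance exceeds `η` with probability at most `δ`, by Hoeffding and a union bound over subsets of
`S`. -/

/-! ### Modulus of continuity of the entropy. -/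

lemma negMulLog_add_le {x t : ℝ} (hx : 0 ≤ x) (ht : 0 ≤ t) :
    Real.negMulLog (x + t) ≤ Real.negMulLog x + Real.negMulLog t := by
  rcases hx.eq_or_lt with rfl | hx
  · simp
  rcases ht.eq_or_lt with rfl | ht
  · simp
  have h₁ : Real.log x ≤ Real.log (x + t) := Real.log_le_log hx (by linarith)
  have h₂ : Real.log t ≤ Real.log (x + t) := Real.log_le_log ht (by linarith)
  simp only [Real.negMulLog]
  nlinarith

lemma negMulLog_sub_negMulLog_add_le {x t : ℝ} (hx : 0 ≤ x) (ht : 0 ≤ t) (h : x + t ≤ 1) :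
    Real.negMulLog x - Real.negMulLog (x + t) ≤ t := by
  have hlog : Real.log (x + t) ≤ 0 := Real.log_nonpos (by linarith) h
  simp only [Real.negMulLog]
  rcases hx.eq_or_lt with rfl | hx
  · simp only [zero_add] at *
    nlinarith
  have h₁ : Real.log (x + t) - Real.log x ≤ t / x := by
    rw [← Real.log_div (by linarith) hx.ne']
    refine (Real.log_le_sub_one_of_pos (by positivity)).trans_eq ?_
    field_simp
    ring
  have h₂ : x * (Real.log (x + t) - Real.log x) ≤ t := by
    calc _ ≤ x * (t / x) := by gcongr
      _ = t := by field_simp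
  nlinarith

/-- The weighted arithmetic-geometric bound `t log (1 / t) + t ≤ t log (1 / c) + c`. -/
lemma negMulLog_add_self_le {t c : ℝ} (ht : 0 ≤ t) (hc : 0 < c) :
    Real.negMulLog t + t ≤ t * -Real.log c + c := by
  rcases ht.eq_or_lt with rfl | ht
  · simpa using hc.le
  have h := Real.log_le_sub_one_of_pos (div_pos hc ht)
  rw [Real.log_div hc.ne' ht.ne'] at h
  have h' : t * (Real.log c - Real.log t) ≤ t * (c / t - 1) := by gcongr
  have h₂ : t * (c / t - 1) = c - t := by field_simp
  simp only [Real.negMulLog]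
  linarith

/-- With `t = |x - y|`, the function rises by at most `negMulLog t` and falls by at most `t`.
Replacing their sum by a bound affine in `t` lets it be summed over letters without Jensen. -/
lemma abs_negMulLog_sub_le {x y c : ℝ} (hx : x ∈ Set.Icc (0 : ℝ) 1) (hy : y ∈ Set.Icc (0 : ℝ) 1)
    (hc : 0 < c) :
    |Real.negMulLog x - Real.negMulLog y| ≤ |x - y| * -Real.log c + c := by
  wlog hxy : x ≤ y generalizing x y
  · rw [abs_sub_comm, abs_sub_comm x]
    exact this hy hx (le_of_not_ge hxy)
  obtain ⟨t, ht, rfl⟩ : ∃ t, 0 ≤ t ∧ x + t = y := ⟨y - x, by linarith, by ring⟩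
  have ht₁ : t ≤ 1 := by linarith [hx.1, hy.2]
  have h₁ := negMulLog_add_le hx.1 ht
  have h₂ := negMulLog_sub_negMulLog_add_le hx.1 ht hy.2
  have h₃ := negMulLog_add_self_le ht hc
  have h₄ := Real.negMulLog_nonneg ht ht₁
  have h₅ : |x - (x + t)| = t := by rw [sub_add_cancel_left, abs_neg, abs_of_nonneg ht]
  rw [h₅, abs_le]
  constructor <;> linarith

/-- Continuity of the entropy with respect to the `ℓ¹` distance. -/
lemma abs_sum_negMulLog_sub_le {α : Type*} [Fintype α] {a b : α → ℝ} {K η : ℝ}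
    (ha : ∀ i, a i ∈ Set.Icc (0 : ℝ) 1) (hb : ∀ i, b i ∈ Set.Icc (0 : ℝ) 1)
    (hη : 0 < η) (hηK : η ≤ K) (hK : Fintype.card α ≤ K) (hab : ∑ i, |a i - b i| ≤ η) :
    |∑ i, Real.negMulLog (a i) - ∑ i, Real.negMulLog (b i)| ≤ phi K η + η := by
  have hK₀ : 0 < K := hη.trans_le hηK
  have hlog : 0 ≤ Real.log (K / η) := Real.log_nonneg ((one_le_div hη).2 hηK)
  calc |∑ i, Real.negMulLog (a i) - ∑ i, Real.negMulLog (b i)|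
      ≤ ∑ i, |Real.negMulLog (a i) - Real.negMulLog (b i)| := by
        rw [← Finset.sum_sub_distrib]
        exact Finset.abs_sum_le_sum_abs _ _
    -- The choice `c = η / K` makes the constant terms add up to at most `η`.
    _ ≤ ∑ i, (|a i - b i| * -Real.log (η / K) + η / K) :=
        Finset.sum_le_sum fun i _ => abs_negMulLog_sub_le (ha i) (hb i) (by positivity)
    _ = (∑ i, |a i - b i|) * Real.log (K / η) + Fintype.card α * (η / K) := by
        rw [← Real.log_inv, inv_div, Finset.sum_add_distrib, Finset.sum_mul]
        simp
    _ ≤ η * Real.log (K / η) + K * (η / K) := by gcongr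
    _ = phi K η + η := by
        rw [phi, mul_div_cancel₀ _ hK₀.ne']

/-! ### Mutual information on finite alphabets. -/

lemma fst_real_singleton {S Ξ : Type*} [MeasurableSpace S] [MeasurableSingletonClass S]
    [Fintype Ξ] [MeasurableSpace Ξ] [MeasurableSingletonClass Ξ]
    (ρ : Measure (S × Ξ)) [IsFiniteMeasure ρ] (s : S) :
    ρ.fst.real {s} = ∑ x, ρ.real {(s, x)} := by
  have h := sum_measureReal_singleton (μ := ρ)
    (Finset.univ.map ⟨fun x : Ξ => (s, x), Prod.mk_right_injective s⟩)
  rw [Finset.sum_map] at h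
  refine Eq.trans ?_ h.symm
  rw [measureReal_def, Measure.fst_apply (measurableSet_singleton s), measureReal_def]
  congr 2
  ext ⟨a, b⟩
  simp [eq_comm]

lemma snd_real_singleton {S Ξ : Type*} [Fintype S] [MeasurableSpace S]
    [MeasurableSingletonClass S] [MeasurableSpace Ξ] [MeasurableSingletonClass Ξ]
    (ρ : Measure (S × Ξ)) [IsFiniteMeasure ρ] (x : Ξ) :
    ρ.snd.real {x} = ∑ s, ρ.real {(s, x)} := by
  have h := sum_measureReal_singleton (μ := ρ)
    (Finset.univ.map ⟨fun s : S => (s, x), Prod.mk_left_injective x⟩)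
  rw [Finset.sum_map] at h
  refine Eq.trans ?_ h.symm
  rw [measureReal_def, Measure.snd_apply (measurableSet_singleton x), measureReal_def]
  congr 2
  ext ⟨a, b⟩
  simp [eq_comm]

section Finite

variable {S Ξ : Type*} [Fintype S] [MeasurableSpace S] [MeasurableSingletonClass S]
  [Fintype Ξ] [MeasurableSpace Ξ] [MeasurableSingletonClass Ξ]

lemma absolutelyContinuous_prod_marginals (ρ : Measure (S × Ξ)) [IsFiniteMeasure ρ] :
    ρ ≪ ρ.fst.prod ρ.snd := by
  intro A hA
  rw [← Set.biUnion_of_singleton A, measure_biUnion_null_iff A.to_countable]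
  rintro ⟨s, x⟩ hsx
  have h₀ : ρ.fst.prod ρ.snd ({s} ×ˢ {x}) = 0 :=
    measure_mono_null (by simpa using hsx) hA
  rw [Measure.prod_prod, mul_eq_zero, Measure.fst_apply (measurableSet_singleton s),
    Measure.snd_apply (measurableSet_singleton x)] at h₀
  rcases h₀ with h₀ | h₀
  · exact measure_mono_null (by simp) h₀
  · exact measure_mono_null (by simp) h₀

/-- On finite spaces the mutual information is finite and equals `H(S) + H(Ξ) - H(S, Ξ)`. -/
lemma mutualInfo_eq_ofReal (ρ : Measure (S × Ξ)) [IsProbabilityMeasure ρ] :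
    mutualInfo ρ = ENNReal.ofReal (∑ s, Real.negMulLog (ρ.fst.real {s})
      + ∑ x, Real.negMulLog (ρ.snd.real {x}) - ∑ p, Real.negMulLog (ρ.real {p})) := by
  have hac := absolutelyContinuous_prod_marginals ρ
  have hllr : ∀ p : S × Ξ, ρ.real {p} * llr ρ (ρ.fst.prod ρ.snd) p =
      ρ.real {p} * (-Real.log (ρ.fst.real {p.1}) - Real.log (ρ.snd.real {p.2}))
        - Real.negMulLog (ρ.real {p}) := by
    rintro ⟨s, x⟩
    have h₁ : (ρ.rnDeriv (ρ.fst.prod ρ.snd) (s, x)).toReal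
        * (ρ.fst.real {s} * ρ.snd.real {x}) = ρ.real {(s, x)} := by
      have h := Measure.setLIntegral_rnDeriv hac {(s, x)}
      rw [lintegral_singleton, ← Set.singleton_prod_singleton, Measure.prod_prod] at h
      rw [Set.singleton_prod_singleton] at h
      rw [measureReal_def ρ, ← h]
      simp [measureReal_def]
    rcases eq_or_ne (ρ.real {(s, x)}) 0 with h₀ | h₀
    · simp [h₀]
    rw [← h₁] at h₀
    have ha : ρ.fst.real {s} ≠ 0 := fun h => h₀ (by simp [h])
    have hb : ρ.snd.real {x} ≠ 0 := fun h => h₀ (by simp [h])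
    have hr : (ρ.rnDeriv (ρ.fst.prod ρ.snd) (s, x)).toReal ≠ 0 := fun h => h₀ (by simp [h])
    have hlog : Real.log (ρ.real {(s, x)}) = llr ρ (ρ.fst.prod ρ.snd) (s, x)
        + (Real.log (ρ.fst.real {s}) + Real.log (ρ.snd.real {x})) := by
      rw [← h₁, Real.log_mul hr (mul_ne_zero ha hb), Real.log_mul ha hb, llr]
    simp only [Real.negMulLog, hlog]
    ring
  rw [mutualInfo, InformationTheory.klDiv_of_ac_of_integrable hac .of_finite,
    integral_fintype .of_finite]
  -- The total-mass correction in `klDiv` cancels, as both measures have mass one.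
  simp only [probReal_univ, add_sub_cancel_right, smul_eq_mul, hllr]
  congr 1
  rw [Finset.sum_sub_distrib]
  congr 1
  simp_rw [mul_sub]
  rw [Finset.sum_sub_distrib, sub_eq_add_neg, ← Finset.sum_neg_distrib, Fintype.sum_prod_type,
    Fintype.sum_prod_type_right]
  congr 1
  · refine Finset.sum_congr rfl fun s _ => ?_
    dsimp only
    rw [← Finset.sum_mul, ← fst_real_singleton, Real.negMulLog]
    ring
  · refine Finset.sum_congr rfl fun x _ => ?_
    dsimp only
    rw [Finset.sum_neg_distrib, ← Finset.sum_mul, ← snd_real_singleton, Real.negMulLog]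
    ring

end Finite

/-! ### Transporting a joint law to a new first marginal. -/

section Transport

variable {S Ξ : Type*} [DecidableEq Ξ] {p q : S → ℝ} {r : S × Ξ → ℝ} {f : S → Ξ}

/-- The joint law with first marginal `q` obtained from a joint law `r` with first marginal `p`:
the common mass `min p q` keeps the conditional law of `r`, the excess mass of `q` goes to `f`. -/
noncomputable def transportWeight (p q : S → ℝ) (r : S × Ξ → ℝ) (f : S → Ξ) (a : S × Ξ) : ℝ :=
  min (p a.1) (q a.1) / p a.1 * r a + if a.2 = f a.1 then max (q a.1 - p a.1) 0 else 0

lemma transportWeight_nonneg (hp : ∀ s, 0 ≤ p s) (hq : ∀ s, 0 ≤ q s) (hr : ∀ a, 0 ≤ r a)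
    (a : S × Ξ) : 0 ≤ transportWeight p q r f a := by
  have := hp a.1
  have := hq a.1
  have := hr a
  rw [transportWeight]
  split_ifs <;> positivity

/-- At `a = 0` both sides vanish because `b ≥ 0`, so rows without mass need no separate treatment
later. -/
lemma min_div_mul_self {a b : ℝ} (hb : 0 ≤ b) : min a b / a * a = min a b := by
  rcases eq_or_ne a 0 with rfl | ha
  · simp [hb]
  · field_simp

lemma sum_transportWeight [Fintype Ξ] (hq : ∀ s, 0 ≤ q s) (hrp : ∀ s, ∑ x, r (s, x) = p s) (s : S) :
    ∑ x, transportWeight p q r f (s, x) = q s := by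
  simp only [transportWeight, Finset.sum_add_distrib, Finset.sum_ite_eq', Finset.mem_univ, if_true]
  rw [← Finset.mul_sum, hrp, min_div_mul_self (hq s)]
  rcases le_total (p s) (q s) with h | h
  · rw [min_eq_left h, max_eq_left (by linarith)]
    ring
  · rw [min_eq_right h, max_eq_right (by linarith)]
    ring

/-- A row either loses mass proportionally or gains mass at one letter, never both, so its total
change is `|q s - p s|`. -/
lemma sum_abs_transportWeight_sub_le [Fintype S] [Fintype Ξ]
    (hp : ∀ s, 0 ≤ p s) (hq : ∀ s, 0 ≤ q s) (hr : ∀ a, 0 ≤ r a)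
    (hrp : ∀ s, ∑ x, r (s, x) = p s) :
    ∑ a, |transportWeight p q r f a - r a| ≤ ∑ s, |q s - p s| := by
  rw [Fintype.sum_prod_type]
  refine Finset.sum_le_sum fun s _ => ?_
  have hc : min (p s) (q s) / p s ≤ 1 := div_le_one_of_le₀ (min_le_left _ _) (hp s)
  calc ∑ x, |transportWeight p q r f (s, x) - r (s, x)|
      ≤ ∑ x, ((1 - min (p s) (q s) / p s) * r (s, x)
          + if x = f s then max (q s - p s) 0 else 0) := by
        refine Finset.sum_le_sum fun x _ => ?_
        have h₁ : 0 ≤ (1 - min (p s) (q s) / p s) * r (s, x) :=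
          mul_nonneg (by linarith) (hr _)
        have h₂ : 0 ≤ if x = f s then max (q s - p s) 0 else 0 := by
          split_ifs <;> simp
        simp only [transportWeight]
        rw [abs_le]
        constructor <;> linarith
    _ = |q s - p s| := by
        simp only [Finset.sum_add_distrib, Finset.sum_ite_eq', Finset.mem_univ, if_true]
        rw [← Finset.mul_sum, hrp, sub_mul, min_div_mul_self (hq s)]
        rcases le_total (p s) (q s) with h | h
        · rw [min_eq_left h, max_eq_left (by linarith), abs_of_nonneg (by linarith)]
          ring
        · rw [min_eq_right h, max_eq_right (by linarith), abs_of_nonpos (by linarith)]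
          ring

end Transport

lemma measureReal_mem_Icc {α : Type*} [MeasurableSpace α] (ρ : Measure α) [IsProbabilityMeasure ρ]
    (A : Set α) : ρ.real A ∈ Set.Icc (0 : ℝ) 1 :=
  ⟨measureReal_nonneg, measureReal_le_one⟩

/-! ### Finiteness of the rate and its continuity in the source. -/

section Finite

variable {S Ξ : Type*} [Fintype S] [MeasurableSpace S] [MeasurableSingletonClass S]
  [Fintype Ξ] [MeasurableSpace Ξ] [MeasurableSingletonClass Ξ]

lemma mutualInfo_ne_top (ρ : Measure (S × Ξ)) [IsProbabilityMeasure ρ] : mutualInfo ρ ≠ ∞ := by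
  rw [mutualInfo_eq_ofReal]
  exact ENNReal.ofReal_ne_top

/-- If every letter of the support can be reproduced without distortion, the rate is finite. -/
lemma rate_ne_top (d : S → Ξ → ℝ≥0) (P : Measure S) [IsProbabilityMeasure P]
    (hd : ∀ s, 0 < P {s} → ∃ x, d s x = 0) (D : ℝ≥0) : rate d P D ≠ ∞ := by
  classical
  obtain ⟨s₀, hs₀⟩ : ∃ s, 0 < P {s} := by
    by_contra! h
    have : P = 0 := Measure.ext_of_singleton fun s => by simpa using h s
    exact IsProbabilityMeasure.ne_zero P this
  obtain ⟨x₀, -⟩ := hd s₀ hs₀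
  have hex : ∀ s, ∃ x, 0 < P {s} → d s x = 0 := fun s =>
    (em (0 < P {s})).elim (fun h => (hd s h).imp fun _ hx _ => hx)
      fun h => ⟨x₀, fun h' => (h h').elim⟩
  choose f hf using hex
  have hm : Measurable fun s => (s, f s) := measurable_of_finite _
  have hρ : IsProbabilityMeasure (P.map fun s => (s, f s)) :=
    Measure.isProbabilityMeasure_map hm.aemeasurable
  -- The deterministic coupling along `f` has zero distortion, hence is feasible at every level.
  refine ne_top_of_le_ne_top (mutualInfo_ne_top (P.map fun s => (s, f s))) (iInf₂_le _ ⟨hρ, ?_, ?_⟩)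
  · rw [Measure.fst, Measure.map_map measurable_fst hm]
    exact Measure.map_id
  · rw [lintegral_map (measurable_of_finite _) hm, lintegral_fintype, Finset.sum_eq_zero]
    · exact zero_le
    · intro s _
      rcases eq_or_ne (P {s}) 0 with h | h
      · simp [h]
      · simp [hf s h.bot_lt]

/-- Continuity of the mutual information with respect to the `ℓ¹` distance of the joint laws. -/
lemma mutualInfo_le_add (ρ ρ' : Measure (S × Ξ)) [IsProbabilityMeasure ρ] [IsProbabilityMeasure ρ']
    {η : ℝ} (hη : 0 < η) (hηK : η ≤ Fintype.card S * Fintype.card Ξ)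
    (h : ∑ a, |ρ'.real {a} - ρ.real {a}| ≤ η) :
    mutualInfo ρ' ≤ mutualInfo ρ
      + ENNReal.ofReal (3 * (phi (Fintype.card S * Fintype.card Ξ) η + η)) := by
  have hcard : 0 < Fintype.card S * Fintype.card Ξ := by
    have : (0 : ℝ) < Fintype.card S * Fintype.card Ξ := hη.trans_le hηK
    exact_mod_cast this
  have hS : (1 : ℝ) ≤ Fintype.card S := by exact_mod_cast Nat.pos_of_mul_pos_right hcard
  have hΞ : (1 : ℝ) ≤ Fintype.card Ξ := by exact_mod_cast Nat.pos_of_mul_pos_left hcard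
  have h₁ : ∑ s, |ρ'.fst.real {s} - ρ.fst.real {s}| ≤ η := by
    refine le_trans ?_ h
    rw [Fintype.sum_prod_type]
    refine Finset.sum_le_sum fun s _ => ?_
    rw [fst_real_singleton, fst_real_singleton, ← Finset.sum_sub_distrib]
    exact Finset.abs_sum_le_sum_abs _ _
  have h₂ : ∑ x, |ρ'.snd.real {x} - ρ.snd.real {x}| ≤ η := by
    refine le_trans ?_ h
    rw [Fintype.sum_prod_type_right]
    refine Finset.sum_le_sum fun x _ => ?_
    rw [snd_real_singleton, snd_real_singleton, ← Finset.sum_sub_distrib]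
    exact Finset.abs_sum_le_sum_abs _ _
  -- Both marginal alphabets have at most `|S||Ξ|` letters, so one modulus serves all three
  -- entropies.
  have e₁ := abs_sum_negMulLog_sub_le (fun _ => measureReal_mem_Icc _ _)
    (fun _ => measureReal_mem_Icc _ _) hη hηK (by nlinarith) h₁
  have e₂ := abs_sum_negMulLog_sub_le (fun _ => measureReal_mem_Icc _ _)
    (fun _ => measureReal_mem_Icc _ _) hη hηK (by nlinarith) h₂
  have e₃ := abs_sum_negMulLog_sub_le (fun _ => measureReal_mem_Icc _ _)
    (fun _ => measureReal_mem_Icc _ _) hη hηK (by simp) h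
  rw [mutualInfo_eq_ofReal, mutualInfo_eq_ofReal]
  refine le_trans (ENNReal.ofReal_le_ofReal ?_) ENNReal.ofReal_add_le
  linarith [(abs_le.1 e₁).2, (abs_le.1 e₂).2, (abs_le.1 e₃).1]

/-- Continuity of the rate-distortion function in the source. -/
lemma rate_le_add (d : S → Ξ → ℝ≥0) (P Q : Measure S) [IsProbabilityMeasure P]
    [IsProbabilityMeasure Q] (hd : ∀ s, 0 < Q {s} → ∃ x, d s x = 0) (D : ℝ≥0)
    {η : ℝ} (hη : 0 < η) (hηK : η ≤ Fintype.card S * Fintype.card Ξ)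
    (h : ∑ s, |Q.real {s} - P.real {s}| ≤ η) :
    rate d Q D ≤ rate d P D
      + ENNReal.ofReal (3 * (phi (Fintype.card S * Fintype.card Ξ) η + η)) := by
  classical
  have : Nonempty Ξ := by
    by_contra hne
    rw [not_nonempty_iff] at hne
    simp at hηK
    linarith
  have hex : ∀ s, ∃ x, 0 < Q {s} → d s x = 0 := fun s =>
    (em (0 < Q {s})).elim (fun h => (hd s h).imp fun _ hx _ => hx)
      fun h => ⟨Classical.arbitrary Ξ, fun h' => (h h').elim⟩
  choose f hf using hex
  simp only [rate, ENNReal.iInf_add]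
  refine le_iInf₂ fun ρ ⟨hρ, hfst, hdist⟩ => ?_
  have hrp : ∀ s, ∑ x, ρ.real {(s, x)} = P.real {s} := fun s => by
    rw [← fst_real_singleton, hfst]
  set w : S × Ξ → ℝ := transportWeight (fun s => P.real {s}) (fun s => Q.real {s})
    (fun a => ρ.real {a}) f with hw
  have hw₀ : ∀ a, 0 ≤ w a := transportWeight_nonneg (fun _ => measureReal_nonneg)
    (fun _ => measureReal_nonneg) fun _ => measureReal_nonneg
  have hwQ : ∀ s, ∑ x, w (s, x) = Q.real {s} :=
    sum_transportWeight (fun _ => measureReal_nonneg) hrp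
  set ρ' : Measure (S × Ξ) := Measure.sum fun a => ENNReal.ofReal (w a) • Measure.dirac a
  have hρ'w : ∀ a, ρ' {a} = ENNReal.ofReal (w a) := fun a => Measure.sum_smul_dirac_singleton
  have hρ'r : ∀ a, ρ'.real {a} = w a := fun a => by
    rw [measureReal_def, hρ'w, ENNReal.toReal_ofReal (hw₀ a)]
  have hprob : IsProbabilityMeasure ρ' := by
    constructor
    rw [← Finset.coe_univ, ← sum_measure_singleton]
    simp only [hρ'w]
    rw [← ENNReal.ofReal_sum_of_nonneg fun a _ => hw₀ a, Fintype.sum_prod_type]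
    simp only [hwQ]
    simp
  have hfeas : ρ' ∈ feasible d Q D := by
    refine ⟨hprob, ?_, ?_⟩
    · rw [ext_iff_measureReal_singleton]
      intro s
      rw [fst_real_singleton]
      simp only [hρ'r, hwQ]
    · refine le_trans ?_ hdist
      rw [lintegral_fintype, lintegral_fintype]
      refine Finset.sum_le_sum fun a _ => ?_
      rcases eq_or_ne (d a.1 a.2) 0 with hda | hda
      · simp [hda]
      refine mul_le_mul_right ?_ _
      rw [hρ'w, ← ofReal_measureReal]
      refine ENNReal.ofReal_le_ofReal ?_
      -- Excess mass lands only on points of zero distortion, so the weight does not increase where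
      -- `d` is positive.
      have hz : (if a.2 = f a.1 then max (Q.real {a.1} - P.real {a.1}) 0 else 0) = 0 := by
        split_ifs with hfa
        · have hQ : Q {a.1} = 0 := by
            by_contra hQ
            exact hda (hfa ▸ hf a.1 (pos_iff_ne_zero.2 hQ))
          simp [measureReal_def, hQ]
        · rfl
      rw [hw, transportWeight, hz, add_zero]
      exact mul_le_of_le_one_left measureReal_nonneg
        (div_le_one_of_le₀ (min_le_left _ _) measureReal_nonneg)
  refine (iInf₂_le ρ' hfeas).trans (mutualInfo_le_add ρ ρ' hη hηK ?_)
  simp only [hρ'r]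
  exact (sum_abs_transportWeight_sub_le (fun _ => measureReal_nonneg)
    (fun _ => measureReal_nonneg) (fun _ => measureReal_nonneg) hrp).trans h

end Finite

/-! ### Concentration of the empirical distribution. -/

section Empirical

variable {S : Type*} [MeasurableSpace S] {z : ℕ}

lemma isProbabilityMeasure_empirical (hz : z ≠ 0) (x : Fin z → S) :
    IsProbabilityMeasure (empirical x) := by
  constructor
  simp [empirical, ENNReal.inv_mul_cancel, hz]

lemma empirical_real_apply (x : Fin z → S) {A : Set S} (hA : MeasurableSet A) :
    (empirical x).real A = (z : ℝ)⁻¹ * ∑ i, A.indicator 1 (x i) := by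
  rw [measureReal_def, empirical, Measure.smul_apply, Measure.finsetSum_apply, smul_eq_mul,
    ENNReal.toReal_mul, ENNReal.toReal_sum fun i _ => measure_ne_top _ _]
  simp only [ENNReal.toReal_inv, ENNReal.toReal_natCast, Measure.dirac_apply' _ hA]
  congr 1
  refine Finset.sum_congr rfl fun i _ => ?_
  by_cases h : x i ∈ A <;> simp [h]

lemma empirical_singleton_eq_zero [MeasurableSingletonClass S] {x : Fin z → S} {s : S}
    (h : ∀ i, x i ≠ s) : empirical x {s} = 0 := by
  simp [empirical, h]

/-- Hoeffding's inequality for the empirical frequency of an event. -/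
lemma measureReal_empirical_sub_ge_le {Ω : Type*} [MeasurableSpace Ω] {μ : Measure Ω}
    [IsProbabilityMeasure μ] {P : Measure S} {X : Fin z → Ω → S} (hX_meas : ∀ i, Measurable (X i))
    (hX_indep : iIndepFun X μ) (hX_law : ∀ i, μ.map (X i) = P) {A : Set S} (hA : MeasurableSet A)
    {t : ℝ} (ht : 0 ≤ t) (hz : z ≠ 0) :
    μ.real {ω | t ≤ (empirical fun i => X i ω).real A - P.real A} ≤ Real.exp (-2 * z * t ^ 2) := by
  have hg : Measurable (A.indicator (1 : S → ℝ)) := measurable_one.indicator hA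
  have hmean : ∀ i, ∫ ω, A.indicator (1 : S → ℝ) (X i ω) ∂μ = P.real A := fun i => by
    rw [← integral_map (hX_meas i).aemeasurable hg.aestronglyMeasurable, hX_law,
      integral_indicator_one hA]
  have hsub : ∀ i, HasSubgaussianMGF (fun ω => A.indicator (1 : S → ℝ) (X i ω) - P.real A)
      ((‖(1 : ℝ) - 0‖₊ / 2) ^ 2) μ := fun i => by
    rw [← hmean i]
    refine hasSubgaussianMGF_of_mem_Icc (hg.comp (hX_meas i)).aemeasurable (.of_forall fun ω => ?_)
    by_cases h : X i ω ∈ A <;> simp [h]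
  have hindep : iIndepFun (fun i ω => A.indicator (1 : S → ℝ) (X i ω) - P.real A) μ :=
    hX_indep.comp (fun _ s => A.indicator (1 : S → ℝ) s - P.real A) fun _ => hg.sub_const _
  have hz₀ : (0 : ℝ) < z := by exact_mod_cast Nat.pos_of_ne_zero hz
  -- Variance proxies `1/4` and threshold `z * t` for the sum give the exponent `-(z t)² / (2 z / 4)
  -- = -2 z t²`.
  have h := HasSubgaussianMGF.measure_sum_ge_le_of_iIndepFun hindep (s := Finset.univ)
    (fun i _ => hsub i) (mul_nonneg hz₀.le ht)
  refine le_trans (le_of_eq ?_) (h.trans (le_of_eq ?_))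
  · congr 1
    ext ω
    simp only [Set.mem_ofPred_eq, empirical_real_apply _ hA, Finset.sum_sub_distrib]
    simp only [Finset.sum_const, Finset.card_univ, Fintype.card_fin, nsmul_eq_mul]
    rw [← mul_le_mul_iff_right₀ hz₀, mul_sub, mul_inv_cancel_left₀ hz₀.ne']
  · congr 1
    simp
    field_simp

end Empirical

/-- The `ℓ¹` distance of two probability measures is twice the excess on some event. -/
lemma exists_sum_abs_sub_eq {S : Type*} [Fintype S] [MeasurableSpace S] [MeasurableSingletonClass S]
    (P Q : Measure S) [IsProbabilityMeasure P] [IsProbabilityMeasure Q] :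
    ∃ A : Finset S, ∑ s, |Q.real {s} - P.real {s}| = 2 * (Q.real A - P.real A) := by
  classical
  refine ⟨Finset.univ.filter fun s => P.real {s} ≤ Q.real {s}, ?_⟩
  have h₀ : ∑ s, (Q.real {s} - P.real {s}) = 0 := by
    rw [Finset.sum_sub_distrib, sum_measureReal_singleton, sum_measureReal_singleton]
    simp
  -- Adding the vanishing sum of `u = Q - P` turns `|u|` into `|u| + u`, which is `2u` on the chosen
  -- event and `0` off it.
  have h₁ : ∑ s, |Q.real {s} - P.real {s}|
      = ∑ s, (|Q.real {s} - P.real {s}| + (Q.real {s} - P.real {s})) := by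
    rw [Finset.sum_add_distrib, h₀, add_zero]
  rw [h₁, ← sum_measureReal_singleton, ← sum_measureReal_singleton, ← Finset.sum_sub_distrib,
    two_mul, Finset.sum_filter, ← Finset.sum_add_distrib]
  refine Finset.sum_congr rfl fun s _ => ?_
  split_ifs with h
  · rw [abs_of_nonneg (by linarith)]
  · rw [abs_of_neg (by linarith)]
    ring

/-- Concentration of the empirical distribution in the `ℓ¹` distance. -/
lemma measureReal_sum_abs_empirical_sub_ge_le {S : Type*} [Fintype S] [MeasurableSpace S]
    [MeasurableSingletonClass S] {z : ℕ} {Ω : Type*} [MeasurableSpace Ω] {μ : Measure Ω}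
    [IsProbabilityMeasure μ] {P : Measure S} [IsProbabilityMeasure P] {X : Fin z → Ω → S}
    (hX_meas : ∀ i, Measurable (X i)) (hX_indep : iIndepFun X μ) (hX_law : ∀ i, μ.map (X i) = P)
    {η : ℝ} (hη : 0 ≤ η) (hz : z ≠ 0) :
    μ.real {ω | η ≤ ∑ s, |(empirical fun i => X i ω).real {s} - P.real {s}|}
      ≤ 2 ^ Fintype.card S * Real.exp (-(z * η ^ 2 / 2)) := by
  -- The extremal event depends on `ω`, hence the union over all subsets.
  calc μ.real {ω | η ≤ ∑ s, |(empirical fun i => X i ω).real {s} - P.real {s}|}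
      ≤ μ.real (⋃ A : Finset S, {ω | η / 2 ≤ (empirical fun i => X i ω).real A - P.real A}) := by
        refine measureReal_mono fun ω hω => ?_
        have := isProbabilityMeasure_empirical hz fun i => X i ω
        obtain ⟨A, hA⟩ := exists_sum_abs_sub_eq P (empirical fun i => X i ω)
        rw [Set.mem_ofPred_eq, hA] at hω
        exact Set.mem_iUnion.2 ⟨A, by rw [Set.mem_ofPred_eq]; linarith⟩
    _ ≤ ∑ A : Finset S, μ.real {ω | η / 2 ≤ (empirical fun i => X i ω).real A - P.real A} :=
        measureReal_iUnion_fintype_le _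
    _ ≤ ∑ _A : Finset S, Real.exp (-2 * z * (η / 2) ^ 2) :=
        Finset.sum_le_sum fun A _ => measureReal_empirical_sub_ge_le hX_meas hX_indep hX_law
          A.measurableSet (by positivity) hz
    _ = 2 ^ Fintype.card S * Real.exp (-(z * η ^ 2 / 2)) := by
        rw [Finset.sum_const, Finset.card_univ, Fintype.card_finset, nsmul_eq_mul]
        push_cast
        congr 2
        ring

lemma two_pow_mul_exp_le {n z : ℕ} {η δ : ℝ} (hη : 0 < η) (hδ : 0 < δ)
    (hz : 2 / η ^ 2 * (Real.log (1 / δ) + n * Real.log 2) ≤ z) :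
    2 ^ n * Real.exp (-(z * η ^ 2 / 2)) ≤ δ := by
  have h : Real.log (1 / δ) + n * Real.log 2 ≤ z * η ^ 2 / 2 := by
    rw [div_mul_eq_mul_div, div_le_iff₀ (by positivity)] at hz
    linarith
  rw [one_div, Real.log_inv] at h
  calc 2 ^ n * Real.exp (-(z * η ^ 2 / 2))
      = Real.exp (n * Real.log 2 - z * η ^ 2 / 2) := by
        rw [sub_eq_add_neg, Real.exp_add, Real.exp_nat_mul, Real.exp_log two_pos]
    _ ≤ Real.exp (Real.log δ) := Real.exp_le_exp.2 (by linarith)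
    _ = δ := Real.exp_log hδ

/-! ### The inverse of `phi`, the least distortion, and the two-sided rate bound. -/

lemma continuous_phi {K : ℝ} (hK : K ≠ 0) : Continuous (phi K) := by
  have : phi K = fun t => t * Real.log K + Real.negMulLog t := by
    ext t
    rcases eq_or_ne t 0 with rfl | ht
    · simp [phi]
    · rw [phi, Real.log_div hK ht, Real.negMulLog]
      ring
  rw [this]
  exact (continuous_id.mul continuous_const).add Real.continuous_negMulLog

/-- `invFunOn` returns some preimage once the intermediate value theorem gives one; injectivity is
not needed, and `v > 0` excludes the preimage `0`. -/
lemma phiInv_spec {K v : ℝ} (hK : 0 < K) (hv : 0 < v) (hvK : v ≤ phi K (1 / 2)) :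
    phiInv K v ∈ Set.Ioc (0 : ℝ) (1 / 2) ∧ phi K (phiInv K v) = v := by
  have hex : ∃ t ∈ Set.Icc (0 : ℝ) (1 / 2), phi K t = v :=
    intermediate_value_Icc (by norm_num) (continuous_phi hK.ne').continuousOn
      ⟨by simpa [phi] using hv.le, hvK⟩
  have hmem : phiInv K v ∈ Set.Icc (0 : ℝ) (1 / 2) := Function.invFunOn_mem hex
  have heq : phi K (phiInv K v) = v := Function.invFunOn_eq hex
  refine ⟨⟨hmem.1.lt_of_ne fun h => ?_, hmem.2⟩, heq⟩
  rw [← h] at heq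
  simp [phi] at heq
  exact hv.ne heq

lemma minDistortion_mem_Ioc {S Ξ : Type*} [Fintype S] [MeasurableSpace S] [Fintype Ξ]
    {P : Measure S} {d : S → Ξ → ℝ≥0} (hd_le : ∀ s x, 0 < P {s} → d s x ≤ 1)
    (hd_pos : ∃ s x, 0 < P {s} ∧ 0 < d s x) : minDistortion d P ∈ Set.Ioc (0 : ℝ) 1 := by
  have hfin : (positiveDistortions d P).Finite := by
    refine (Set.finite_range fun a : S × Ξ => (d a.1 a.2 : ℝ)).subset ?_
    rintro r ⟨s, x, -, -, rfl⟩
    exact ⟨(s, x), rfl⟩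
  obtain ⟨s, x, hs, hx⟩ := hd_pos
  have hne : (positiveDistortions d P).Nonempty := ⟨_, s, x, hs, hx, rfl⟩
  obtain ⟨s, x, hs, hx, h⟩ := hne.csInf_mem hfin
  rw [minDistortion, h]
  exact ⟨hx, hd_le s x hs⟩

/-- Both directions of the continuity of the rate-distortion function in the source. -/
lemma abs_rate_sub_le {S Ξ : Type*} [Fintype S] [MeasurableSpace S] [MeasurableSingletonClass S]
    [Fintype Ξ] [MeasurableSpace Ξ] [MeasurableSingletonClass Ξ]
    (d : S → Ξ → ℝ≥0) (P Q : Measure S) [IsProbabilityMeasure P] [IsProbabilityMeasure Q]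
    (hP : ∀ s, 0 < P {s} → ∃ x, d s x = 0) (hQ : ∀ s, 0 < Q {s} → ∃ x, d s x = 0) (D : ℝ≥0)
    {η : ℝ} (hη : 0 < η) (hηK : η ≤ Fintype.card S * Fintype.card Ξ)
    (h : ∑ s, |Q.real {s} - P.real {s}| ≤ η) :
    |(rate d P D).toReal - (rate d Q D).toReal|
      ≤ 3 * (phi (Fintype.card S * Fintype.card Ξ) η + η) := by
  have hφ : 0 ≤ 3 * (phi (Fintype.card S * Fintype.card Ξ) η + η) := by
    have := Real.log_nonneg ((one_le_div hη).2 hηK)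
    rw [phi]
    positivity
  have key : ∀ {a b : ℝ≥0∞} {c : ℝ}, b ≠ ∞ → 0 ≤ c → a ≤ b + ENNReal.ofReal c →
      a.toReal ≤ b.toReal + c := fun {a b c} hb hc hab => by
    have := ENNReal.toReal_mono (ENNReal.add_ne_top.2 ⟨hb, ENNReal.ofReal_ne_top⟩) hab
    rwa [ENNReal.toReal_add hb ENNReal.ofReal_ne_top, ENNReal.toReal_ofReal hc] at this
  have h₁ := key (rate_ne_top d P hP D) hφ (rate_le_add d P Q hQ D hη hηK h)
  simp_rw [abs_sub_comm (Q.real _)] at h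
  have h₂ := key (rate_ne_top d Q hQ D) hφ (rate_le_add d Q P hP D hη hηK h)
  rw [abs_le]
  constructor <;> linarith

end RateDistortion

/-! ### Assembly of the probability bound. -/

theorem mainTheorem2
    {S Ξ : Type*} [Fintype S] [MeasurableSpace S] [MeasurableSingletonClass S]
    [Fintype Ξ] [MeasurableSpace Ξ] [MeasurableSingletonClass Ξ]
    (P : Measure S) [IsProbabilityMeasure P]
    (d : S → Ξ → ℝ≥0)
    (hd_le : ∀ s x, 0 < P {s} → d s x ≤ 1)
    (hd_zero : ∀ s, 0 < P {s} → ∃ x, d s x = 0)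
    (hd_pos : ∃ s x, 0 < P {s} ∧ 0 < d s x)
    {Ω : Type*} [MeasurableSpace Ω] (μ : Measure Ω) [IsProbabilityMeasure μ]
    (z : ℕ) (X : Fin z → Ω → S)
    (hX_meas : ∀ i, Measurable (X i))
    (hX_indep : iIndepFun X μ)
    (hX_law : ∀ i, μ.map (X i) = P)
    (δ ε : ℝ) (hδ : δ ∈ Set.Ioo (0 : ℝ) 1)
    (hε : ε ∈ Set.Ioo (0 : ℝ) (Real.log (Fintype.card S)))
    (hz : 2 / phiInv (Fintype.card S * Fintype.card Ξ) (ε * minDistortion d P / 7) ^ 2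
        * (Real.log (1 / δ) + Fintype.card S * Real.log 2) ≤ z)
    (D : ℝ≥0) :
    rate d P D ≠ ∞ ∧
    (∀ᵐ ω ∂μ, rate d (empirical fun i => X i ω) D ≠ ∞) ∧
    μ.real {ω | ε ≤ |(rate d P D).toReal - (rate d (empirical fun i => X i ω) D).toReal|} ≤ δ := by
  obtain ⟨hδ₀, hδ₁⟩ := hδ
  obtain ⟨hε₀, hε₁⟩ := hε
  obtain ⟨hm₀, hm₁⟩ := minDistortion_mem_Ioc hd_le hd_pos
  have hS : (2 : ℝ) ≤ Fintype.card S := by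
    have h : (1 : ℝ) < Fintype.card S := by
      by_contra! h
      linarith [Real.log_nonpos (Nat.cast_nonneg _) h]
    exact_mod_cast h
  have hΞ : (1 : ℝ) ≤ Fintype.card Ξ := by
    obtain ⟨s, x, -⟩ := hd_pos
    exact_mod_cast Fintype.card_pos_iff.2 ⟨x⟩
  set K : ℝ := Fintype.card S * Fintype.card Ξ with hK
  have hSK : (Fintype.card S : ℝ) ≤ K := by rw [hK]; nlinarith
  have hv₀ : 0 < ε * minDistortion d P / 7 := by positivity
  -- `phi K (1 / 2)` is at least `log |S| / 2`, which exceeds `ε / 2`.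
  have hv₁ : ε * minDistortion d P / 7 ≤ phi K (1 / 2) := by
    have h : Real.log (Fintype.card S) ≤ Real.log (K / (1 / 2)) :=
      Real.log_le_log (by linarith) (by linarith)
    rw [phi]
    nlinarith
  obtain ⟨⟨hη₀, hη₁⟩, hφ⟩ := phiInv_spec (by linarith) hv₀ hv₁
  set η := phiInv K (ε * minDistortion d P / 7) with hη
  have hlogδ : 0 < Real.log (1 / δ) := Real.log_pos ((one_lt_div hδ₀).2 hδ₁)
  have hz₀ : z ≠ 0 := by
    rintro rfl
    have : 0 < 2 / η ^ 2 * (Real.log (1 / δ) + Fintype.card S * Real.log 2) := by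
      have := Real.log_pos one_lt_two
      positivity
    rw [Nat.cast_zero] at hz
    linarith
  have hgap : 3 * (phi K η + η) < ε := by
    -- `K ≥ 2` and `η ≤ 1/2` give `K / η ≥ 4 > e`.
    have h4 : 1 ≤ Real.log (K / η) := by
      rw [Real.le_log_iff_exp_le (div_pos (by linarith) hη₀), le_div_iff₀ hη₀]
      nlinarith [Real.exp_one_lt_d9, Real.exp_pos 1]
    have h5 : η ≤ phi K η := by
      rw [phi]
      nlinarith
    nlinarith
  -- Samples almost surely stay in the support of `P`, so the empirical source inherits its
  -- zero-distortion letters.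
  have hsupp : ∀ᵐ ω ∂μ, ∀ s, 0 < empirical (fun i => X i ω) {s} → ∃ x, d s x = 0 := by
    have h : ∀ᵐ ω ∂μ, ∀ i, 0 < P {X i ω} := by
      refine ae_all_iff.2 fun i => ae_of_ae_map (p := fun s => 0 < P {s}) (hX_meas i).aemeasurable ?_
      rw [hX_law, ae_iff_of_countable]
      exact fun s hs => pos_iff_ne_zero.2 hs
    filter_upwards [h] with ω hω s hs
    by_contra hne
    refine hs.ne' (empirical_singleton_eq_zero fun i hi => hne (hd_zero s ?_))
    exact hi ▸ hω i
  refine ⟨rate_ne_top d P hd_zero D, ?_, ?_⟩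
  · filter_upwards [hsupp] with ω hω
    have := isProbabilityMeasure_empirical hz₀ fun i => X i ω
    exact rate_ne_top d _ hω D
  · calc μ.real {ω | ε ≤ |(rate d P D).toReal - (rate d (empirical fun i => X i ω) D).toReal|}
        ≤ μ.real {ω | η ≤ ∑ s, |(empirical fun i => X i ω).real {s} - P.real {s}|} := by
          refine ENNReal.toReal_mono (measure_ne_top _ _) (measure_mono_ae ?_)
          filter_upwards [hsupp] with ω hω hle
          by_contra hlt
          have := isProbabilityMeasure_empirical hz₀ fun i => X i ω
          have h := abs_rate_sub_le d P (empirical fun i => X i ω) hd_zero hω D hη₀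
            (by linarith) (le_of_not_ge hlt)
          exact absurd (hle.trans h) (not_le.2 hgap)
      _ ≤ 2 ^ Fintype.card S * Real.exp (-(z * η ^ 2 / 2)) :=
          measureReal_sum_abs_empirical_sub_ge_le hX_meas hX_indep hX_law hη₀.le hz₀
      _ ≤ δ := two_pow_mul_exp_le hη₀ hδ₀ hz
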